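/- Let $(\Omega,\mathcal F,\mathbb P)$ be an atomless probability space, let $L^0$ be the set of its real random variables and $L^\infty$ the set of the essentially bounded ones. A function $\varphi:\mathbb R^d\to\mathbb R$ is supermodular if $\varphi(\mathbf x)+\varphi(\mathbf y)\le\varphi(\mathbf x\wedge\mathbf y)+\varphi(\mathbf x\vee\mathbf y)$ for all $\mathbf x,\mathbf y\in\mathbb R^d$, with componentwise minimum and maximum, and right-continuous if $\varphi(\mathbf y)\to\varphi(\mathbf x)$ as $\mathbf y\to\mathbf x$ with $\mathbf y\ge\mathbf x$ componentwise, for every $\mathbf x$. For $\mathbf X,\mathbf Y\in(L^0)^d$ consider the inequality $\mathbb E[\varphi(\mathbf X)]\le\mathbb E[\varphi(\mathbf Y)]$. We write - $\mathbf X\le_{\rm sm}\mathbf Y$ if it holds for all supermodular $\varphi$ for which both expectations are well-defined in $[-\infty,\infty]$ (an expectation $\mathbb E[Z]$ is well-defined if $\mathbb E[Z_+]<\infty$ or $\mathbb E[Z_-]<\infty$); - $\mathbf X\le^\dagger_{\rm sm}\mathbf Y$ if it holds for all supermodular $\varphi$ for which both expectations are finite; - $\mathbf X\le^\diamond_{\rm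 sm}\mathbf Y$ if it holds for all bounded right-continuous supermodular $\varphi$. A pair $(X,Y)$ in $(L^0)^2$ is comonotonic if $X=f(Z)$ and $Y=g(Z)$ almost surely for some $Z\in L^0$ and some increasing (i.e. nondecreasing) functions $f,g:\mathbb R\to\mathbb R$; it is counter-monotonic if $(X,-Y)$ is comonotonic. A comonotonic version $\mathbf X^{\rm co}$ of $\mathbf X\in(L^0)^d$ is a vector in $(L^0)^d$ whose components are pairwise comonotonic and such that $X_i^{\rm co}$ has the same distribution as $X_i$ for each $i$. (1) For every $d\ge2$ and every $\mathbf X\in(L^0)^d$, a comonotonic version of $\mathbf X$ exists, and $\mathbf X\le^\diamond_{\rm sm}\mathbf X^{\rm co}$ for every comonotonic version $\mathbf X^{\rm co}$ of $\mathbf X$. (2) For every $d\ge3$ there is $\mathbf X\in(L^\infty)^d$ such that both $\mathbf X\le^\dagger_{\rm sm}\mathbf X^{\rm co}$ and $\mathbf X\le_{\rm sm}\mathbf X^{\rm co}$ fail for every comonotonic version $\mathbf X^{\rm co}$ of $\mathbf X$ (and such versions exist). (3) The function $\varphi:\mathbb R^3\to\mathbb R$, $\varphi(x,y,z)=\frac1x\mathbf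 1_{\{0<x<1\}}+\frac1y\mathbf 1_{\{0<y<1\}}-\frac2z\mathbf 1_{\{0<z<1\}}$, is separable (a sum of functions of the single coordinates), supermodular and unbounded. There are random variables $X,Y,Z$, each uniformly distributed on $[0,1]$, such that $(X,Y)$ and $(1/X+1/Y,\,Z)$ are counter-monotonic, $\varphi(X,Y,Z)$ is integrable and $\mathbb E[\varphi(X,Y,Z)]=2\log2>0$, whereas $\varphi(X^{\rm co},Y^{\rm co},Z^{\rm co})=0$ almost surely for every comonotonic version $(X^{\rm co},Y^{\rm co},Z^{\rm co})$ of $(X,Y,Z)$. -/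

import Mathlib

open MeasureTheory ProbabilityTheory

noncomputable section

namespace SMOrder

/-- A measure is atomless if every measurable set of positive measure has a measurable subset
of strictly smaller positive measure. -/
def Atomless {Ω : Type*} [MeasurableSpace Ω] (P : Measure Ω) : Prop :=
  ∀ A : Set Ω, MeasurableSet A → 0 < P A →
    ∃ B : Set Ω, B ⊆ A ∧ MeasurableSet B ∧ 0 < P B ∧ P B < P A

/-- Supermodular functions on `ℝ^d`; `⊓` and `⊔` are the componentwise minimum and maximum. -/
def Supermodular {d : ℕ} (φ : (Fin d → ℝ) → ℝ) : Prop :=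
  ∀ x y : Fin d → ℝ, φ x + φ y ≤ φ (x ⊓ y) + φ (x ⊔ y)

/-- Right-continuity on `ℝ^d`: `φ y → φ x` as `y → x` with `y ≥ x` componentwise. -/
def RightContinuous {d : ℕ} (φ : (Fin d → ℝ) → ℝ) : Prop :=
  ∀ x : Fin d → ℝ, ContinuousWithinAt φ (Set.Ici x) x

/-- Bounded functions on `ℝ^d`. -/
def BoundedFun {d : ℕ} (φ : (Fin d → ℝ) → ℝ) : Prop :=
  ∃ C : ℝ, ∀ x : Fin d → ℝ, |φ x| ≤ C

/-- Separable functions: sums of functions of the single coordinates. -/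
def Separable {d : ℕ} (φ : (Fin d → ℝ) → ℝ) : Prop :=
  ∃ g : Fin d → ℝ → ℝ, ∀ x : Fin d → ℝ, φ x = ∑ i, g i (x i)

section Orders

variable {Ω : Type*} [MeasurableSpace Ω]

/-- The expectation of `Y` is well-defined: `E[Y₊] < ∞` or `E[Y₋] < ∞`. -/
def ExpWellDefined (P : Measure Ω) (Y : Ω → ℝ) : Prop :=
  AEMeasurable Y P ∧
    ((∫⁻ ω, ENNReal.ofReal (Y ω) ∂P) < ⊤ ∨ (∫⁻ ω, ENNReal.ofReal (-Y ω) ∂P) < ⊤)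

/-- The extended-real expectation `E[Y₊] - E[Y₋]`, used only when it is well-defined. -/
def expectation (P : Measure Ω) (Y : Ω → ℝ) : EReal :=
  ((∫⁻ ω, ENNReal.ofReal (Y ω) ∂P : ENNReal) : EReal)
    - ((∫⁻ ω, ENNReal.ofReal (-Y ω) ∂P : ENNReal) : EReal)

/-- The random vector with components `X i`. -/
def vec {d : ℕ} (X : Fin d → Ω → ℝ) (ω : Ω) : Fin d → ℝ := fun i => X i ω

/-- Supermodular order: all supermodular functions for which both expectations are
well-defined (possibly infinite). -/
def LeSM {d : ℕ} (P : Measure Ω) (X Y : Fin d → Ω → ℝ) : Prop :=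
  ∀ φ : (Fin d → ℝ) → ℝ, Supermodular φ →
    ExpWellDefined P (fun ω => φ (vec X ω)) → ExpWellDefined P (fun ω => φ (vec Y ω)) →
      expectation P (fun ω => φ (vec X ω)) ≤ expectation P (fun ω => φ (vec Y ω))

/-- Dagger supermodular order: all supermodular functions for which both expectations are
finite. -/
def LeSMDagger {d : ℕ} (P : Measure Ω) (X Y : Fin d → Ω → ℝ) : Prop :=
  ∀ φ : (Fin d → ℝ) → ℝ, Supermodular φ →
    Integrable (fun ω => φ (vec X ω)) P → Integrable (fun ω => φ (vec Y ω)) P →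
      ∫ ω, φ (vec X ω) ∂P ≤ ∫ ω, φ (vec Y ω) ∂P

/-- Diamond supermodular order: all bounded right-continuous supermodular functions. Right-continuous
functions are Borel, so for random vectors on a probability space both integrals exist. -/
def LeSMDiamond {d : ℕ} (P : Measure Ω) (X Y : Fin d → Ω → ℝ) : Prop :=
  ∀ φ : (Fin d → ℝ) → ℝ, Supermodular φ → BoundedFun φ → RightContinuous φ →
    ∫ ω, φ (vec X ω) ∂P ≤ ∫ ω, φ (vec Y ω) ∂P

/-- A pair of random variables is comonotonic if both are almost surely increasing functions of
a common random variable. -/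
def ComonotonicPair (P : Measure Ω) (X Y : Ω → ℝ) : Prop :=
  ∃ (Z : Ω → ℝ) (f g : ℝ → ℝ), Measurable Z ∧ Monotone f ∧ Monotone g ∧
    (∀ᵐ ω ∂P, X ω = f (Z ω)) ∧ (∀ᵐ ω ∂P, Y ω = g (Z ω))

/-- `(X, Y)` is counter-monotonic if `(X, -Y)` is comonotonic. -/
def CounterMonotonicPair (P : Measure Ω) (X Y : Ω → ℝ) : Prop :=
  ComonotonicPair P X (fun ω => -Y ω)

/-- A random vector is comonotonic if its components are pairwise comonotonic. -/
def Comonotonic {d : ℕ} (P : Measure Ω) (X : Fin d → Ω → ℝ) : Prop :=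
  ∀ i j : Fin d, i ≠ j → ComonotonicPair P (X i) (X j)

/-- `X'` is a comonotonic version of `X`: a comonotonic random vector with the same marginal
distributions. -/
def IsComonotonicVersion {d : ℕ} (P : Measure Ω) (X X' : Fin d → Ω → ℝ) : Prop :=
  (∀ i, Measurable (X' i)) ∧ Comonotonic P X' ∧ ∀ i, IdentDistrib (X' i) (X i) P P

end Orders

/-- The function `(x, y, z) ↦ (1/x) 1_{0<x<1} + (1/y) 1_{0<y<1} - (2/z) 1_{0<z<1}`. -/
def phiEx (x : Fin 3 → ℝ) : ℝ :=
  (Set.Ioo (0 : ℝ) 1).indicator (fun t => 1 / t) (x 0)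
    + (Set.Ioo (0 : ℝ) 1).indicator (fun t => 1 / t) (x 1)
    - (Set.Ioo (0 : ℝ) 1).indicator (fun t => 2 / t) (x 2)

end SMOrder

end

noncomputable section

namespace SMOrder

/-! ### A uniform random variable on an atomless space. -/

section Atomless

open Filter Topology

variable {Ω : Type*} [MeasurableSpace Ω] {P : Measure Ω}

/-! Existence of comonotonic versions is the quantile coupling: an atomless space carries a uniform
variable, and all the quantile functions are applied to that one variable.

Domination in the diamond order is a duality argument. Rounding each coordinate up to a finite grid
preserves minima and maxima, so `φ` becomes a supermodular `ψ` on a box of the integer lattice. The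
rounded comonotonic vector lives on a chain, and `exists_separable_majorant` gives `∑ i, g i` that
dominates `ψ` on the box and equals it on the chain. Expectations of separable functions see only
the marginals, hence `E ψ(X) ≤ ∑ E g i (X i) = ∑ E g i (Y i) = E ψ(Y)`. Right-continuity and
boundedness let the mesh tend to zero.

The counterexample exploits cancelling infinities: each term of `phiEx` has infinite mean under
uniform marginals, so the marginals do not fix the mean of the sum. For `(U, 1 - U, 2 min(U, 1 -
U))` the singularities cancel and leave `1 / max(U, 1 - U)`, with mean `2 log 2`. A comonotonic
vector with equal marginals has almost surely equal components, and `phiEx` vanishes on the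
diagonal. -/

theorem Atomless.exists_subset_half [IsFiniteMeasure P] (hP : Atomless P) {A : Set Ω}
    (hA : MeasurableSet A) (hA0 : 0 < P.real A) :
    ∃ B ⊆ A, MeasurableSet B ∧ 0 < P.real B ∧ P.real B ≤ P.real A / 2 := by
  obtain ⟨B, hBA, hB, hB0, hBlt⟩ := hP A hA (by
    rwa [measureReal_def, ENNReal.toReal_pos_iff, and_iff_left (measure_lt_top P A)] at hA0)
  have h0 : 0 < P.real B := ENNReal.toReal_pos hB0.ne' (measure_ne_top P B)
  have h1 : P.real B < P.real A :=
    (ENNReal.toReal_lt_toReal (measure_ne_top P B) (measure_ne_top P A)).2 hBlt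
  have h2 : P.real (A \ B) = P.real A - P.real B := measureReal_sdiff hBA hB
  -- Either `B` or its complement in `A` has at most half the mass.
  rcases le_total (P.real B) (P.real A / 2) with h | h
  · exact ⟨B, hBA, hB, h0, h⟩
  · exact ⟨A \ B, Set.sdiff_subset, hA.diff hB, by linarith, by linarith⟩

theorem Atomless.exists_subset_small [IsFiniteMeasure P] (hP : Atomless P) {A : Set Ω}
    (hA : MeasurableSet A) (hA0 : 0 < P.real A) {ε : ℝ} (hε : 0 < ε) :
    ∃ B ⊆ A, MeasurableSet B ∧ 0 < P.real B ∧ P.real B < ε := by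
  have key : ∀ n : ℕ, ∃ B ⊆ A, MeasurableSet B ∧ 0 < P.real B ∧
      P.real B ≤ P.real A * (1 / 2) ^ n := by
    intro n
    induction n with
    | zero => exact ⟨A, subset_rfl, hA, hA0, by simp⟩
    | succ n ih =>
      obtain ⟨B, hBA, hB, hB0, hle⟩ := ih
      obtain ⟨C, hCB, hC, hC0, hle'⟩ := hP.exists_subset_half hB hB0
      exact ⟨C, hCB.trans hBA, hC, hC0, by rw [pow_succ]; linarith⟩
  obtain ⟨n, hn⟩ := exists_pow_lt_of_lt_one (div_pos hε hA0) (by norm_num : (1 / 2 : ℝ) < 1)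
  obtain ⟨B, hBA, hB, hB0, hle⟩ := key n
  refine ⟨B, hBA, hB, hB0, hle.trans_lt ?_⟩
  rw [lt_div_iff₀ hA0] at hn
  linarith

/-- Sierpiński's theorem: an atomless finite measure takes all intermediate values. -/
theorem Atomless.exists_subset_measureReal_eq [IsFiniteMeasure P] (hP : Atomless P) {A : Set Ω}
    (hA : MeasurableSet A) {t : ℝ} (ht0 : 0 ≤ t) (htA : t ≤ P.real A) :
    ∃ B ⊆ A, MeasurableSet B ∧ P.real B = t := by
  let F : Set (Set Ω) := {C | C ⊆ A ∧ MeasurableSet C ∧ P.real C ≤ t}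
  -- Greedy exhaustion: `C'` realizes at least half of the largest gain possible above `C` within
  -- `F`.
  have step : ∀ C : F, ∃ C' : F, (C : Set Ω) ⊆ C' ∧
      ∀ D ∈ F, (C : Set Ω) ⊆ D → P.real D ≤ 2 * P.real C' - P.real C := by
    rintro ⟨C, hC⟩
    let S : Set ℝ := {r | ∃ D ∈ F, C ⊆ D ∧ r = P.real D}
    have hS : S.Nonempty := ⟨_, C, hC, subset_rfl, rfl⟩
    have hbdd : BddAbove S := ⟨t, by rintro _ ⟨D, hD, -, rfl⟩; exact hD.2.2⟩
    have hCs : P.real C ≤ sSup S := le_csSup hbdd ⟨C, hC, subset_rfl, rfl⟩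
    rcases hCs.eq_or_lt with h | h
    · refine ⟨⟨C, hC⟩, subset_rfl, fun D hD hCD => ?_⟩
      have := le_csSup hbdd ⟨D, hD, hCD, rfl⟩
      simp only
      linarith
    · obtain ⟨_, ⟨C', hC', hCC', rfl⟩, hlt⟩ :=
        exists_lt_of_lt_csSup hS (show (P.real C + sSup S) / 2 < sSup S by linarith)
      refine ⟨⟨C', hC'⟩, hCC', fun D hD hCD => ?_⟩
      have := le_csSup hbdd ⟨D, hD, hCD, rfl⟩
      simp only
      linarith
  choose next hnext hnext' using step
  let B : ℕ → F := fun n => Nat.rec ⟨∅, by simp, .empty, by simpa⟩ (fun _ C => next C) n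
  have hmono : Monotone (fun n : ℕ => (B n).1) :=
    monotone_nat_of_le_succ (by intro n; exact hnext (B n))
  let U : Set Ω := ⋃ n, (B n).1
  have hUA : U ⊆ A := Set.iUnion_subset fun n => (B n).2.1
  have hU : MeasurableSet U := .iUnion fun n => (B n).2.2.1
  have hlim : Tendsto (fun n => P.real (B n).1) atTop (𝓝 (P.real U)) :=
    (ENNReal.tendsto_toReal (measure_ne_top P U)).comp (tendsto_measure_iUnion_atTop (μ := P) hmono)
  have hUt : P.real U ≤ t := le_of_tendsto' hlim fun n => (B n).2.2.2
  refine ⟨U, hUA, hU, hUt.antisymm (le_of_not_gt fun hlt => ?_)⟩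
  have hpos : 0 < P.real (A \ U) := by rw [measureReal_sdiff hUA hU]; linarith
  obtain ⟨D, hDA, hD, hD0, hDlt⟩ :=
    hP.exists_subset_small (hA.diff hU) hpos (show 0 < t - P.real U by linarith)
  have hUD : P.real (U ∪ D) = P.real U + P.real D :=
    measureReal_union (Set.disjoint_of_subset_right hDA Set.disjoint_sdiff_right) hD
  have hmem : U ∪ D ∈ F :=
    ⟨Set.union_subset hUA (hDA.trans Set.sdiff_subset), hU.union hD, by linarith⟩
  -- The right side tends to `P.real U`, so the possible gain is exhausted and no `D` of positive
  -- mass can be added.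
  have hle : ∀ n, P.real (U ∪ D) ≤ 2 * P.real (B (n + 1)).1 - P.real (B n).1 := fun n =>
    hnext' (B n) _ hmem ((Set.subset_iUnion (fun n => (B n).1) n).trans
      Set.subset_union_left)
  have hlim' := ((hlim.comp (tendsto_add_atTop_nat 1)).const_mul 2).sub hlim
  have := ge_of_tendsto' hlim' hle
  linarith

/-- `K` is uniformly distributed on `{0, …, 2 ^ n - 1}`. -/
def IsDyadicUniform (P : Measure Ω) (n : ℕ) (K : Ω → ℕ) : Prop :=
  Measurable K ∧ (∀ ω, K ω < 2 ^ n) ∧ ∀ k < 2 ^ n, P.real (K ⁻¹' {k}) = (1 / 2) ^ n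

theorem IsDyadicUniform.measureReal_lt [IsFiniteMeasure P] {n : ℕ} {K : Ω → ℕ}
    (hK : IsDyadicUniform P n K) {m : ℕ} (hm : m ≤ 2 ^ n) :
    P.real {ω | K ω < m} = m * (1 / 2) ^ n := by
  induction m with
  | zero => simp
  | succ m ih =>
    have h : {ω | K ω < m + 1} = {ω | K ω < m} ∪ K ⁻¹' {m} := by
      ext ω; simp; omega
    rw [h, measureReal_union _ (hK.1 (measurableSet_singleton m)), ih (by omega),
      hK.2.2 m (by omega)]
    · push_cast; ring
    · rw [Set.disjoint_left]
      intro ω h1 h2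
      simp at h1 h2
      omega

/-- Each cell of `K` is cut into two halves of equal mass, and the new binary digit records the
half. -/
theorem Atomless.exists_refinement [IsFiniteMeasure P] (hP : Atomless P) {n : ℕ} {K : Ω → ℕ}
    (hK : IsDyadicUniform P n K) :
    ∃ K', IsDyadicUniform P (n + 1) K' ∧ ∀ ω, 2 * K ω ≤ K' ω ∧ K' ω ≤ 2 * K ω + 1 := by
  classical
  have hmeas : ∀ k, MeasurableSet (K ⁻¹' {k}) := fun k => hK.1 (measurableSet_singleton k)
  have hB : ∀ k, ∃ B ⊆ K ⁻¹' {k}, MeasurableSet B ∧ P.real B = P.real (K ⁻¹' {k}) / 2 := by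
    intro k
    have := measureReal_nonneg (μ := P) (s := K ⁻¹' {k})
    exact hP.exists_subset_measureReal_eq (hmeas k) (by linarith) (by linarith)
  choose B hBK hB hPB using hB
  let K' : Ω → ℕ := fun ω => 2 * K ω + if ω ∈ ⋃ k, B k then 1 else 0
  have hmemB : ∀ ω, ω ∈ (⋃ k, B k) ↔ ω ∈ B (K ω) := by
    intro ω
    simp only [Set.mem_iUnion]
    refine ⟨fun ⟨k, hk⟩ => ?_, fun h => ⟨_, h⟩⟩
    have : K ω = k := hBK k hk
    rwa [this]
  have hodd : ∀ k, K' ⁻¹' {2 * k + 1} = B k := by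
    intro k
    ext ω
    simp only [K', hmemB, Set.mem_preimage, Set.mem_singleton_iff]
    constructor
    · intro h
      split_ifs at h with h'
      · have : K ω = k := by omega
        rwa [this] at h'
      · omega
    · intro h
      have : K ω = k := hBK k h
      rw [this, if_pos h]
  have heven : ∀ k, K' ⁻¹' {2 * k} = K ⁻¹' {k} \ B k := by
    intro k
    ext ω
    simp only [K', hmemB, Set.mem_preimage, Set.mem_singleton_iff, Set.mem_sdiff]
    constructor
    · intro h
      split_ifs at h with h'
      · omega
      · have : K ω = k := by omega
        exact ⟨this, by rwa [this] at h'⟩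
    · rintro ⟨h, h'⟩
      rw [h, if_neg h', add_zero]
  refine ⟨K', ⟨?_, fun ω => ?_, fun k hk => ?_⟩, fun ω => ?_⟩
  · exact (hK.1.const_mul 2).add (Measurable.ite (.iUnion hB) measurable_const measurable_const)
  · have := hK.2.1 ω
    simp only [K', pow_succ]
    split_ifs <;> omega
  · rw [pow_succ] at hk
    obtain ⟨j, rfl | rfl⟩ := Nat.even_or_odd' k
    · rw [heven, measureReal_sdiff (hBK j) (hB j), hPB, hK.2.2 j (by omega), pow_succ]
      ring
    · rw [hodd, hPB, hK.2.2 j (by omega), pow_succ]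
      ring
  · simp only [K']
    split_ifs <;> omega

/-- An atomless probability space carries a uniformly distributed random variable. -/
theorem Atomless.exists_measureReal_le_eq [IsProbabilityMeasure P] (hP : Atomless P) :
    ∃ U : Ω → ℝ, Measurable U ∧ ∀ t ∈ Set.Icc (0 : ℝ) 1, P.real {ω | U ω ≤ t} = t := by
  have h0 : IsDyadicUniform P 0 (fun _ => 0) :=
    ⟨measurable_const, by simp, fun k hk => by
      obtain rfl : k = 0 := by simpa using hk
      simp [Set.preimage_const_of_mem]⟩
  choose next hnext hnext' using
    fun (n : ℕ) (K : {K : Ω → ℕ // IsDyadicUniform P n K}) => hP.exists_refinement K.2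
  let K : (n : ℕ) → {K : Ω → ℕ // IsDyadicUniform P n K} :=
    fun n => Nat.rec ⟨_, h0⟩ (fun n K => ⟨next n K, hnext n K⟩) n
  have hK : ∀ n ω, 2 * (K n).1 ω ≤ (K (n + 1)).1 ω ∧ (K (n + 1)).1 ω ≤ 2 * (K n).1 ω + 1 :=
    fun n ω => hnext' n (K n) ω
  -- The digits read so far: `a n` increases and `a n + (1 / 2) ^ n` decreases, which encloses the
  -- limit `U`.
  let a : ℕ → Ω → ℝ := fun n ω => (K n).1 ω * (1 / 2) ^ n
  have ha_mono : ∀ ω, Monotone fun n => a n ω := by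
    refine fun ω => monotone_nat_of_le_succ fun n => ?_
    have h : (2 * (K n).1 ω : ℝ) ≤ (K (n + 1)).1 ω := by exact_mod_cast (hK n ω).1
    simp only [a, pow_succ]
    have : (0 : ℝ) < (1 / 2) ^ n := by positivity
    nlinarith
  have hb_anti : ∀ ω, Antitone fun n => a n ω + (1 / 2) ^ n := by
    refine fun ω => antitone_nat_of_succ_le fun n => ?_
    have h : ((K (n + 1)).1 ω : ℝ) ≤ 2 * (K n).1 ω + 1 := by exact_mod_cast (hK n ω).2
    simp only [a, pow_succ]
    have : (0 : ℝ) < (1 / 2) ^ n := by positivity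
    nlinarith
  have hab : ∀ ω n m, a n ω ≤ a m ω + (1 / 2) ^ m := by
    intro ω n m
    refine (ha_mono ω (le_max_left n m)).trans (le_trans ?_ (hb_anti ω (le_max_right n m)))
    simp
  have hbdd : ∀ ω, BddAbove (Set.range fun n => a n ω) := fun ω =>
    ⟨a 0 ω + (1 / 2) ^ 0, by rintro _ ⟨n, rfl⟩; exact hab ω n 0⟩
  let U : Ω → ℝ := fun ω => ⨆ n, a n ω
  have hUl : ∀ ω n, a n ω ≤ U ω := fun ω n => le_ciSup (hbdd ω) n
  have hUr : ∀ ω n, U ω ≤ a n ω + (1 / 2) ^ n := fun ω n => ciSup_le fun m => hab ω m n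
  have hUm : Measurable U := by
    refine Measurable.iSup fun n => ?_
    exact (measurable_from_nat.comp (K n).2.1).mul_const _
  refine ⟨U, hUm, fun t ht => ?_⟩
  rcases ht.2.eq_or_lt with rfl | ht1
  · have : {ω | U ω ≤ 1} = Set.univ := by
      ext ω
      have h := hUr ω 0
      have h1 := (K 0).2.2.1 ω
      have h2 : (K 0).1 ω = 0 := by simpa using h1
      simp only [a, h2] at h
      simpa using h
    rw [this]
    simp
  have key : ∀ n : ℕ, |P.real {ω | U ω ≤ t} - t| ≤ (1 / 2) ^ n := by
    intro n
    -- With this `m`, the event `U ≤ t` lies between `K n < m` and `K n < m + 1`, whose masses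
    -- differ by `(1 / 2) ^ n`.
    set m := ⌊(2 : ℝ) ^ n * t⌋₊ with hm
    have hp : (0 : ℝ) < 2 ^ n := by positivity
    have hq : (0 : ℝ) < (1 / 2) ^ n := by positivity
    have hpq : (2 : ℝ) ^ n * (1 / 2) ^ n = 1 := by rw [← mul_pow]; norm_num
    have hm1 : (m : ℝ) ≤ 2 ^ n * t := Nat.floor_le (mul_nonneg hp.le ht.1)
    have hm2 : 2 ^ n * t < m + 1 := Nat.lt_floor_add_one _
    have hmlt : m < 2 ^ n := by
      have : (m : ℝ) < 2 ^ n := by nlinarith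
      exact_mod_cast this
    have hm1' : m * (1 / 2) ^ n ≤ t := by nlinarith
    have hm2' : t ≤ (m + 1) * (1 / 2) ^ n := by nlinarith
    have e1 := (K n).2.measureReal_lt hmlt.le
    have e2 := (K n).2.measureReal_lt (m := m + 1) hmlt
    have s1 : P.real {ω | (K n).1 ω < m} ≤ P.real {ω | U ω ≤ t} := by
      refine measureReal_mono fun ω (hω : (K n).1 ω < m) => ?_
      have : ((K n).1 ω : ℝ) + 1 ≤ m := by exact_mod_cast hω
      refine (hUr ω n).trans (le_trans ?_ hm1')
      simp only [a]
      nlinarith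
    have s2 : P.real {ω | U ω ≤ t} ≤ P.real {ω | (K n).1 ω < m + 1} := by
      refine measureReal_mono fun ω (hω : U ω ≤ t) => ?_
      have h1 : (K n).1 ω * (1 / 2) ^ n ≤ t := (hUl ω n).trans hω
      have : ((K n).1 ω : ℝ) < m + 1 := by
        refine lt_of_le_of_lt ?_ hm2
        nlinarith
      exact_mod_cast this
    rw [e1] at s1
    rw [e2] at s2
    push_cast at s2
    rw [abs_le]
    constructor <;> linarith
  have hz : |P.real {ω | U ω ≤ t} - t| ≤ 0 :=
    ge_of_tendsto' (tendsto_pow_atTop_nhds_zero_of_lt_one (by norm_num) (by norm_num)) key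
  linarith [abs_nonpos_iff.1 hz]

end Atomless

/-! ### Uniform distribution on the unit interval. -/

section Uniform

variable {Ω : Type*} [MeasurableSpace Ω] {P : Measure Ω}

theorem volume_Icc_zero_one : (volume : Measure ℝ) (Set.Icc 0 1) = 1 := by simp

theorem isUniform_Icc_of_measureReal_le [IsProbabilityMeasure P] {U : Ω → ℝ} (hU : Measurable U)
    (h : ∀ t ∈ Set.Icc (0 : ℝ) 1, P.real {ω | U ω ≤ t} = t) :
    pdf.IsUniform U (Set.Icc (0 : ℝ) 1) P volume := by
  have h' : ∀ t ∈ Set.Icc (0 : ℝ) 1, P {ω | U ω ≤ t} = ENNReal.ofReal t := fun t ht => by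
    rw [← ofReal_measureReal, h t ht]
  have := Measure.isProbabilityMeasure_map (μ := P) hU.aemeasurable
  refine Measure.ext_of_Iic _ _ fun t => ?_
  rw [Measure.map_apply hU measurableSet_Iic, cond_apply measurableSet_Icc, volume_Icc_zero_one,
    inv_one, one_mul]
  change P {ω | U ω ≤ t} = _
  rcases lt_or_ge t 0 with ht | ht
  · have e : Set.Icc (0 : ℝ) 1 ∩ Set.Iic t = ∅ := by
      ext x; simp; intro h1 _; linarith
    rw [e, measure_empty]
    refine measure_mono_null (t := {ω | U ω ≤ 0}) (fun ω (hω : U ω ≤ t) => hω.trans ht.le) ?_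
    simpa using h' 0 (by simp)
  rcases le_or_gt t 1 with ht1 | ht1
  · have e : Set.Icc (0 : ℝ) 1 ∩ Set.Iic t = Set.Icc 0 t := by
      ext x; simp; intro h1 _; linarith
    rw [e, h' t ⟨ht, ht1⟩, Real.volume_Icc, sub_zero]
  · have e : Set.Icc (0 : ℝ) 1 ∩ Set.Iic t = Set.Icc 0 1 := by
      ext x; simp; intro h1 h2; linarith
    rw [e, volume_Icc_zero_one]
    refine le_antisymm prob_le_one ?_
    calc (1 : ENNReal) = P {ω | U ω ≤ 1} := by simpa using (h' 1 (by simp)).symm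
      _ ≤ _ := measure_mono fun ω (hω : U ω ≤ 1) => hω.trans ht1.le

theorem Atomless.exists_isUniform [IsProbabilityMeasure P] (hP : Atomless P) :
    ∃ U : Ω → ℝ, Measurable U ∧ pdf.IsUniform U (Set.Icc (0 : ℝ) 1) P volume := by
  obtain ⟨U, hU, h⟩ := hP.exists_measureReal_le_eq
  exact ⟨U, hU, isUniform_Icc_of_measureReal_le hU h⟩

variable {U : Ω → ℝ}

theorem measure_preimage_of_isUniform_Icc (hu : pdf.IsUniform U (Set.Icc (0 : ℝ) 1) P volume)
    {A : Set ℝ} (hA : MeasurableSet A) : P (U ⁻¹' A) = volume (Set.Icc 0 1 ∩ A) := by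
  rw [hu.measure_preimage (by rw [volume_Icc_zero_one]; exact one_ne_zero)
    measure_Icc_lt_top.ne hA, volume_Icc_zero_one, div_one]

theorem ae_mem_Ioo_of_isUniform_Icc (hu : pdf.IsUniform U (Set.Icc (0 : ℝ) 1) P volume) :
    ∀ᵐ ω ∂P, U ω ∈ Set.Ioo (0 : ℝ) 1 := by
  change P (U ⁻¹' (Set.Ioo (0 : ℝ) 1)ᶜ) = 0
  rw [measure_preimage_of_isUniform_Icc hu measurableSet_Ioo.compl]
  refine measure_mono_null (t := {0, 1}) ?_ ((Set.toFinite _).measure_zero _)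
  rintro x ⟨⟨h1, h2⟩, h3⟩
  simp only [Set.mem_compl_iff, Set.mem_Ioo, not_and_or, not_lt] at h3
  rcases h3 with h3 | h3
  · exact Or.inl (h3.antisymm h1)
  · exact Or.inr (h2.antisymm h3)

theorem measure_le_of_isUniform_Icc (hu : pdf.IsUniform U (Set.Icc (0 : ℝ) 1) P volume)
    {t : ℝ} (ht : t ≤ 1) : P {ω | U ω ≤ t} = ENNReal.ofReal t := by
  have e : Set.Icc (0 : ℝ) 1 ∩ Set.Iic t = Set.Icc 0 t := by
    ext x; simp; intro h1 _; linarith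
  rw [← sub_zero t, ← Real.volume_Icc, ← e, sub_zero,
    ← measure_preimage_of_isUniform_Icc hu measurableSet_Iic]
  rfl

end Uniform

/-! ### Quantile functions. -/

section Quantile

open Filter Topology

/-- The left-continuous quantile function of a probability measure on the line. -/
def quantile (μ : Measure ℝ) (u : ℝ) : ℝ := sInf {x | u ≤ cdf μ x}

variable (μ : Measure ℝ)

theorem quantile_set_nonempty {u : ℝ} (hu : u < 1) : {x | u ≤ cdf μ x}.Nonempty :=
  ((tendsto_cdf_atTop μ).eventually (eventually_ge_nhds hu)).exists

theorem quantile_set_bddBelow {u : ℝ} (hu : 0 < u) : BddBelow {x | u ≤ cdf μ x} := by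
  obtain ⟨y, hy⟩ := ((tendsto_cdf_atBot μ).eventually (eventually_lt_nhds hu)).exists
  exact ⟨y, fun x hx => le_of_not_gt fun hxy =>
    absurd (hx.trans (monotone_cdf μ hxy.le)) (not_le.2 hy)⟩

/-- Right-continuity of the distribution function makes the infimum attained. -/
theorem quantile_le_iff {u : ℝ} (hu : u ∈ Set.Ioo (0 : ℝ) 1) (x : ℝ) :
    quantile μ u ≤ x ↔ u ≤ cdf μ x := by
  refine ⟨fun h => ?_, fun h => csInf_le (quantile_set_bddBelow μ hu.1) h⟩
  have h1 : ∀ y, x < y → u ≤ cdf μ y := fun y hy => by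
    obtain ⟨z, hz, hzy⟩ := exists_lt_of_csInf_lt (quantile_set_nonempty μ hu.2) (h.trans_lt hy)
    exact le_trans hz (monotone_cdf μ hzy.le)
  have h2 : Tendsto (cdf μ) (𝓝[>] x) (𝓝 (cdf μ x)) :=
    ((cdf μ).right_continuous x).mono_left (nhdsWithin_mono _ Set.Ioi_subset_Ici_self)
  exact ge_of_tendsto h2 (eventually_nhdsWithin_of_forall h1)

/-- Comonotonicity asks for functions monotone on all of `ℝ`. Outside `(0, 1)` the `sInf` may take
its default value, so the argument is first squeezed into `(0, 1)`. -/
theorem monotone_quantile_sigmoid : Monotone fun z => quantile μ (Real.sigmoid z) :=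
  fun a b hab => csInf_le_csInf (quantile_set_bddBelow μ (Real.sigmoid_pos a))
    (quantile_set_nonempty μ (Real.sigmoid_lt_one b))
    fun _ hx => (Real.sigmoid_monotone hab).trans hx

end Quantile

/-! ### Existence of comonotonic versions, and rigidity for equal marginals. -/

section ComonotonicVersion

variable {Ω : Type*} [MeasurableSpace Ω] {P : Measure Ω}

/-- Take `Z` to be the logit of a uniform variable, so that its sigmoid is almost surely that
variable. -/
theorem Atomless.exists_measure_sigmoid_le [IsProbabilityMeasure P] (hP : Atomless P) :
    ∃ Z : Ω → ℝ, Measurable Z ∧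
      ∀ t ≤ 1, P {ω | Real.sigmoid (Z ω) ≤ t} = ENNReal.ofReal t := by
  obtain ⟨U, hU, hu⟩ := hP.exists_isUniform
  refine ⟨fun ω => -Real.log ((U ω)⁻¹ - 1), by fun_prop, fun t ht => ?_⟩
  rw [← measure_le_of_isUniform_Icc hu ht]
  refine measure_congr ?_
  filter_upwards [ae_mem_Ioo_of_isUniform_Icc hu] with ω hω
  have h1 : 0 < (U ω)⁻¹ - 1 := sub_pos.2 ((one_lt_inv₀ hω.1).2 hω.2)
  have h2 : Real.sigmoid (-Real.log ((U ω)⁻¹ - 1)) = U ω := by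
    rw [Real.sigmoid_def, neg_neg, Real.exp_log h1]
    simp
  change (Real.sigmoid (-Real.log ((U ω)⁻¹ - 1)) ≤ t) = (U ω ≤ t)
  rw [h2]

theorem Atomless.exists_isComonotonicVersion [IsProbabilityMeasure P] (hP : Atomless P) {d : ℕ}
    {X : Fin d → Ω → ℝ} (hX : ∀ i, Measurable (X i)) : ∃ Xco, IsComonotonicVersion P X Xco := by
  obtain ⟨Z, hZ, hZP⟩ := hP.exists_measure_sigmoid_le
  have hq := fun i => monotone_quantile_sigmoid (P.map (X i))
  have hm : ∀ i, Measurable fun ω => quantile (P.map (X i)) (Real.sigmoid (Z ω)) :=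
    fun i => (hq i).measurable.comp hZ
  refine ⟨fun i ω => quantile (P.map (X i)) (Real.sigmoid (Z ω)), hm, fun i j _ =>
    ⟨Z, _, _, hZ, hq i, hq j, .of_forall fun _ => rfl, .of_forall fun _ => rfl⟩, fun i =>
    ⟨(hm i).aemeasurable, (hX i).aemeasurable, ?_⟩⟩
  have := Measure.isProbabilityMeasure_map (μ := P) (hX i).aemeasurable
  have := Measure.isProbabilityMeasure_map (μ := P) (hm i).aemeasurable
  refine Measure.ext_of_Iic _ _ fun x => ?_
  rw [Measure.map_apply (hm i) measurableSet_Iic, ← ofReal_cdf,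
    ← hZP _ (cdf_le_one (P.map (X i)) x)]
  congr 1
  ext ω
  exact quantile_le_iff _ ⟨Real.sigmoid_pos _, Real.sigmoid_lt_one _⟩ _

/-- For rational `q` the events `X ≤ q` and `Y ≤ q` are, almost surely, preimages under `Z` of lower
sets of the line. These are nested, and equal probability forces the events to agree almost surely.
-/
theorem ComonotonicPair.ae_eq_of_identDistrib [IsFiniteMeasure P] {X Y : Ω → ℝ}
    (hX : Measurable X) (hY : Measurable Y) (h : ComonotonicPair P X Y)
    (hd : IdentDistrib X Y P P) : X =ᵐ[P] Y := by
  obtain ⟨Z, f, g, -, hf, hg, hXf, hYg⟩ := h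
  have key : ∀ q : ℚ, ∀ᵐ ω ∂P, X ω ≤ q ↔ Y ω ≤ q := by
    intro q
    have hX' : MeasurableSet {ω | X ω ≤ q} := measurableSet_le hX measurable_const
    have hY' : MeasurableSet {ω | Y ω ≤ q} := measurableSet_le hY measurable_const
    have hP : P {ω | X ω ≤ q} = P {ω | Y ω ≤ q} := hd.measure_mem_eq (measurableSet_Iic (a := (q : ℝ)))
    have hl : IsLowerSet {z | f z ≤ q} := fun a b hab (ha : f a ≤ q) => (hf hab).trans ha
    have hl' : IsLowerSet {z | g z ≤ q} := fun a b hab (ha : g a ≤ q) => (hg hab).trans ha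
    have heq : {ω | X ω ≤ q} =ᵐ[P] {ω | Y ω ≤ q} := by
      rcases hl.total hl' with hs | hs
      · refine ae_eq_of_ae_subset_of_measure_ge ?_ hP.ge hX'.nullMeasurableSet (measure_ne_top _ _)
        filter_upwards [hXf, hYg] with ω h1 h2 (h3 : X ω ≤ q)
        change Y ω ≤ q
        rw [h2]
        exact hs (show f (Z ω) ≤ q by rwa [← h1])
      · refine (ae_eq_of_ae_subset_of_measure_ge ?_ hP.le hY'.nullMeasurableSet
          (measure_ne_top _ _)).symm
        filter_upwards [hXf, hYg] with ω h1 h2 (h3 : Y ω ≤ q)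
        change X ω ≤ q
        rw [h1]
        exact hs (show g (Z ω) ≤ q by rwa [← h2])
    filter_upwards [heq] with ω hω
    exact Iff.of_eq hω
  filter_upwards [ae_all_iff.2 key] with ω hω
  refine le_antisymm (le_of_forall_rat_lt_imp_le ?_) (le_of_forall_rat_lt_imp_le ?_)
  · intro q hq
    by_contra hlt
    exact absurd ((hω q).2 (not_le.1 hlt).le) (not_le.2 hq)
  · intro q hq
    by_contra hlt
    exact absurd ((hω q).1 (not_le.1 hlt).le) (not_le.2 hq)

end ComonotonicVersion

/-! ### Separable majorants of supermodular functions on a lattice box. -/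

section Dual

variable {d : ℕ}

/-- The largest chain element strictly below `b` drops in some coordinate, and every smaller one
then drops there too. This lets a box be shrunk by one layer that meets the chain at most at its top
corner. -/
theorem exists_coordinate_lt_of_isChain {C : Set (Fin d → ℕ)} (hC : IsChain (· ≤ ·) C)
    {b : Fin d → ℕ} (hb : b ≠ 0) :
    ∃ i, 0 < b i ∧ ∀ x ∈ C, x ≤ b → x ≠ b → x i < b i := by
  by_contra! hcon
  obtain ⟨i₀, hi₀⟩ : ∃ i, b i ≠ 0 := by
    by_contra! h
    exact hb (funext h)
  have hfin : (C ∩ {x | x ≤ b ∧ x ≠ b}).Finite :=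
    (Set.finite_Iic b).subset fun x hx => hx.2.1
  obtain ⟨x₀, hx₀, hx₀b, hx₀ne, -⟩ := hcon i₀ (Nat.pos_of_ne_zero hi₀)
  obtain ⟨m, hm⟩ := hfin.exists_maximal ⟨x₀, hx₀, hx₀b, hx₀ne⟩
  obtain ⟨hmC, hmb, hmne⟩ := hm.prop
  obtain ⟨i, hi⟩ : ∃ i, m i < b i := by
    by_contra! h
    exact hmne (le_antisymm hmb h)
  obtain ⟨x, hx, hxb, hxne, hxi⟩ := hcon i (by omega)
  have hxm : x ≤ m := by
    rcases hC.total hx hmC with h | h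
    · exact h
    · exact hm.le_of_ge ⟨hx, hxb, hxne⟩ h
  exact absurd (hxm i) (not_le.2 (hi.trans_le hxi))

/-- Dual potentials for a supermodular function on a box of the integer lattice: a separable
majorant which is tight along a given chain. -/
theorem exists_separable_majorant {ψ : (Fin d → ℕ) → ℝ}
    (hψ : ∀ x y, ψ x + ψ y ≤ ψ (x ⊓ y) + ψ (x ⊔ y)) {C : Set (Fin d → ℕ)}
    (hC : IsChain (· ≤ ·) C) (b : Fin d → ℕ) (hd : 0 < d) :
    ∃ g : Fin d → ℕ → ℝ, (∀ x ≤ b, ψ x ≤ ∑ i, g i (x i)) ∧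
      (∀ x ∈ C, x ≤ b → ψ x = ∑ i, g i (x i)) ∧ ψ b = ∑ i, g i (b i) := by
  classical
  induction hn : ∑ i, b i generalizing b with
  | zero =>
    have hb : b = 0 := by
      funext i
      exact (Finset.sum_eq_zero_iff.1 hn) i (Finset.mem_univ i)
    subst hb
    have hx0 : ∀ x : Fin d → ℕ, x ≤ 0 → x = 0 := fun x hx => le_antisymm hx zero_le
    have hd' : (d : ℝ) ≠ 0 := by positivity
    have hsum : ψ 0 = ∑ _i : Fin d, ψ 0 / d := by
      rw [Finset.sum_const, Finset.card_univ, Fintype.card_fin, nsmul_eq_mul, mul_div_cancel₀ _ hd']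
    exact ⟨fun _ _ => ψ 0 / d, fun x hx => by rw [hx0 x hx]; exact hsum.le,
      fun x _ hx => by rw [hx0 x hx]; exact hsum, hsum⟩
  | succ n ih =>
    obtain ⟨i, hi, hiC⟩ := exists_coordinate_lt_of_isChain hC (b := b)
      (by rintro rfl; simp at hn)
    set b' : Fin d → ℕ := Function.update b i (b i - 1) with hb'
    have hb'i : b' i = b i - 1 := by simp [b']
    have hb'j : ∀ j, j ≠ i → b' j = b j := fun j hj => by simp [b', hj]
    have hsumb : ∑ j, b' j = n := by
      have h1 := Finset.add_sum_erase Finset.univ b (Finset.mem_univ i)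
      have h2 := Finset.add_sum_erase Finset.univ b' (Finset.mem_univ i)
      have h3 : ∑ j ∈ Finset.univ.erase i, b' j = ∑ j ∈ Finset.univ.erase i, b j :=
        Finset.sum_congr rfl fun j hj => hb'j j (Finset.ne_of_mem_erase hj)
      omega
    obtain ⟨g', hle, heq, htop⟩ := ih b' hsumb
    have hle_b' : ∀ x ≤ b, x i < b i → x ≤ b' := by
      intro x hx hxi j
      by_cases hj : j = i
      · rw [hj, hb'i]; exact Nat.le_sub_one_of_lt hxi
      · rw [hb'j j hj]; exact hx j
    -- Only the value of the `i`-th potential on the removed layer is new. It is forced by tightness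
    -- at `b`, given tightness of `g'` at `b'`.
    let g : Fin d → ℕ → ℝ := fun j k =>
      if j = i ∧ b i ≤ k then g' i (b i - 1) + (ψ b - ψ b') else g' j k
    have hg_lt : ∀ x : Fin d → ℕ, x i < b i → ∑ j, g j (x j) = ∑ j, g' j (x j) := by
      intro x hx
      refine Finset.sum_congr rfl fun j _ => if_neg ?_
      rintro ⟨rfl, h⟩
      omega
    have hg_eq : ∀ x : Fin d → ℕ, x i = b i →
        ∑ j, g j (x j) = ∑ j, g' j (Function.update x i (b i - 1) j) + (ψ b - ψ b') := by
      intro x hx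
      rw [← Finset.add_sum_erase _ _ (Finset.mem_univ i),
        ← Finset.add_sum_erase _ (fun j => g' j _) (Finset.mem_univ i)]
      have : ∑ j ∈ Finset.univ.erase i, g j (x j)
          = ∑ j ∈ Finset.univ.erase i, g' j (Function.update x i (b i - 1) j) := by
        refine Finset.sum_congr rfl fun j hj => ?_
        have hj := Finset.ne_of_mem_erase hj
        simp [g, hj]
      rw [this]
      simp only [g, hx, le_refl, and_self, if_true, Function.update_self]
      ring
    have htop' : ψ b = ∑ j, g j (b j) := by
      rw [hg_eq b rfl, ← hb', ← htop]
      ring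
    refine ⟨g, fun x hx => ?_, fun x hxC hx => ?_, htop'⟩
    · rcases (hx i).lt_or_eq with hxi | hxi
      · rw [hg_lt x hxi]
        exact hle x (hle_b' x hx hxi)
      · have hinf : x ⊓ b' = Function.update x i (b i - 1) := by
          funext j
          by_cases hj : j = i
          · rw [hj, Pi.inf_apply, hb'i, hxi, Function.update_self]; exact min_eq_right (Nat.sub_le _ _)
          · simp [hj, hb'j j hj, hx j]
        have hsup : x ⊔ b' = b := by
          funext j
          by_cases hj : j = i
          · rw [hj, Pi.sup_apply, hb'i, hxi]; exact max_eq_left (Nat.sub_le _ _)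
          · simp [hb'j j hj, hx j]
        -- On the layer `x i = b i`, supermodularity bounds the increment of `ψ` at `x` by its
        -- increment `ψ b - ψ b'` at the top corner.
        have h1 := hψ x b'
        rw [hinf, hsup] at h1
        have h2 := hle (Function.update x i (b i - 1)) (hinf ▸ inf_le_right)
        rw [hg_eq x hxi]
        linarith
    · by_cases hxb : x = b
      · rw [hxb]; exact htop'
      · have hxi := hiC x hxC hx hxb
        rw [hg_lt x hxi]
        exact heq x hxC (hle_b' x hx hxi)

end Dual

/-! ### Domination in the diamond order, by discretization. -/

section Diamond

open Filter Topology

variable {Ω : Type*} [MeasurableSpace Ω] {P : Measure Ω} {d : ℕ}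

theorem integrable_comp_of_finite [IsFiniteMeasure P] {α : Type*} [MeasurableSpace α]
    [DiscreteMeasurableSpace α] (f : α → ℝ) {V : Ω → α} (hV : Measurable V) {S : Set α}
    (hS : S.Finite) (hVS : ∀ ω, V ω ∈ S) : Integrable (fun ω => f (V ω)) P := by
  obtain ⟨C, hC⟩ := (hS.image fun a => |f a|).bddAbove
  refine Integrable.of_bound
    ((Measurable.of_discrete (f := f)).comp hV).aestronglyMeasurable C (.of_forall fun ω => ?_)
  exact hC ⟨V ω, hVS ω, rfl⟩

/-- The atoms of a monotone discretization of a comonotonic vector form a chain. -/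
theorem Comonotonic.isChain_atoms {X : Fin d → Ω → ℝ} (hX : Comonotonic P X) {K : ℝ → ℕ}
    (hK : Monotone K) :
    IsChain (· ≤ ·) {c : Fin d → ℕ | P {ω | (fun i => K (X i ω)) = c} ≠ 0} := by
  intro c hc c' hc' _
  by_contra! hcon
  obtain ⟨h1, h2⟩ := hcon
  simp only [Pi.le_def, not_forall, not_le] at h1 h2
  obtain ⟨j, hj⟩ := h1
  obtain ⟨i, hi⟩ := h2
  have hij : i ≠ j := by rintro rfl; omega
  obtain ⟨Z, f, g, -, hf, hg, hXf, hXg⟩ := hX i j hij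
  -- An atom of positive mass contains a sample point where the almost sure representations hold.
  -- Two incomparable atoms would then order the values of `Z` in contradictory ways.
  have hex : ∀ c : Fin d → ℕ, P {ω | (fun i => K (X i ω)) = c} ≠ 0 →
      ∃ ω, (fun i => K (X i ω)) = c ∧ X i ω = f (Z ω) ∧ X j ω = g (Z ω) := by
    intro c hc
    obtain ⟨ω, h, hω⟩ := ((frequently_ae_mem_iff.2 hc).and_eventually (hXf.and hXg)).exists
    exact ⟨ω, h, hω⟩
  obtain ⟨ω, h, hfω, hgω⟩ := hex c hc
  obtain ⟨ω', h', hfω', hgω'⟩ := hex c' hc'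
  rw [← h, ← h'] at hi hj
  simp only [hfω, hgω, hfω', hgω'] at hi hj
  have hz : Z ω < Z ω' := lt_of_not_ge fun hle => absurd (hK (hf hle)) (not_le.2 hi)
  exact absurd (hK (hg hz.le)) (not_le.2 hj)

/-- Weak duality: the majorant is integrated against `X`, transferred by the marginals, and is tight
on the atoms of `Y`. -/
theorem integral_le_of_isComonotonicVersion_discrete [IsProbabilityMeasure P] (hd : 0 < d)
    {X Y : Fin d → Ω → ℝ} (hX : ∀ i, Measurable (X i)) (hY : IsComonotonicVersion P X Y)
    {K : ℝ → ℕ} (hK : Monotone K) {N : ℕ} (hN : ∀ x, K x ≤ N) {ψ : (Fin d → ℕ) → ℝ}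
    (hψ : ∀ x y, ψ x + ψ y ≤ ψ (x ⊓ y) + ψ (x ⊔ y)) :
    ∫ ω, ψ (fun i => K (X i ω)) ∂P ≤ ∫ ω, ψ (fun i => K (Y i ω)) ∂P := by
  obtain ⟨hYm, hYc, hYd⟩ := hY
  obtain ⟨g, hle, heq, -⟩ := exists_separable_majorant hψ (hYc.isChain_atoms hK) (fun _ => N) hd
  have hKX : ∀ i, Measurable fun ω => K (X i ω) := fun i => hK.measurable.comp (hX i)
  have hKY : ∀ i, Measurable fun ω => K (Y i ω) := fun i => hK.measurable.comp (hYm i)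
  have hgX : ∀ i, Integrable (fun ω => g i (K (X i ω))) P := fun i =>
    integrable_comp_of_finite _ (hKX i) (Set.finite_Iic N) fun ω => hN _
  have hgY : ∀ i, Integrable (fun ω => g i (K (Y i ω))) P := fun i =>
    integrable_comp_of_finite _ (hKY i) (Set.finite_Iic N) fun ω => hN _
  have hψX : Integrable (fun ω => ψ fun i => K (X i ω)) P :=
    integrable_comp_of_finite ψ (V := fun ω i => K (X i ω)) (measurable_pi_lambda _ hKX)
      (Set.finite_Iic fun _ => N) fun ω i => hN _
  have hYC : ∀ᵐ ω ∂P, (fun i => K (Y i ω)) ∈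
      {c : Fin d → ℕ | P {ω | (fun i => K (Y i ω)) = c} ≠ 0} := by
    have : ∀ c : Fin d → ℕ, ∀ᵐ ω ∂P, (fun i => K (Y i ω)) = c →
        P {ω | (fun i => K (Y i ω)) = c} ≠ 0 := by
      intro c
      by_cases hc : P {ω | (fun i => K (Y i ω)) = c} = 0
      · filter_upwards [measure_eq_zero_iff_ae_notMem.1 hc] with ω hω h
        exact absurd h hω
      · exact .of_forall fun _ _ => hc
    filter_upwards [ae_all_iff.2 this] with ω hω
    exact hω _ rfl
  calc ∫ ω, ψ (fun i => K (X i ω)) ∂P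
      ≤ ∫ ω, ∑ i, g i (K (X i ω)) ∂P :=
        integral_mono hψX (integrable_finsetSum _ fun i _ => hgX i)
          fun ω => hle _ fun i => hN _
    _ = ∑ i, ∫ ω, g i (K (X i ω)) ∂P := integral_finsetSum _ fun i _ => hgX i
    _ = ∑ i, ∫ ω, g i (K (Y i ω)) ∂P := Finset.sum_congr rfl fun i _ =>
        (((hYd i).comp hK.measurable).comp
          (Measurable.of_discrete (f := g i))).integral_eq.symm
    _ = ∫ ω, ∑ i, g i (K (Y i ω)) ∂P := (integral_finsetSum _ fun i _ => hgY i).symm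
    _ = ∫ ω, ψ (fun i => K (Y i ω)) ∂P := by
        refine integral_congr_ae ?_
        filter_upwards [hYC] with ω hω
        exact (heq _ hω fun i => hN _).symm

/-- The index of the cell of the grid of mesh `1 / (n + 1)` on `[-(n + 1), n + 1]` containing
a point. -/
def gridIndex (n : ℕ) (x : ℝ) : ℕ := min ⌊(x + (n + 1)) * (n + 1)⌋₊ (2 * (n + 1) ^ 2)

/-- The right end point of a cell of the grid. -/
def gridPoint (n : ℕ) (k : ℕ) : ℝ := (k + 1) / (n + 1) - (n + 1)

theorem monotone_gridIndex (n : ℕ) : Monotone (gridIndex n) := fun x y hxy =>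
  min_le_min_right _ (Nat.floor_mono (by gcongr))

theorem monotone_gridPoint (n : ℕ) : Monotone (gridPoint n) := fun x y hxy => by
  unfold gridPoint
  gcongr

/-- Rounding goes upwards so that the approximations fit right-continuity. For `|x| ≤ n` the cap in
`gridIndex` is inactive. -/
theorem gridPoint_gridIndex_bounds {n : ℕ} {x : ℝ} (hx : |x| ≤ n) :
    x ≤ gridPoint n (gridIndex n x) ∧ gridPoint n (gridIndex n x) ≤ x + 1 / (n + 1) := by
  obtain ⟨h1, h2⟩ := abs_le.1 hx
  have hn : (0 : ℝ) < n + 1 := by positivity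
  have h0 : 0 ≤ (x + (n + 1)) * (n + 1) := mul_nonneg (by linarith) hn.le
  have hle : ⌊(x + (n + 1)) * (n + 1)⌋₊ ≤ 2 * (n + 1) ^ 2 := by
    refine Nat.floor_le_of_le ?_
    push_cast
    nlinarith
  have h3 := Nat.floor_le h0
  have h4 := Nat.lt_floor_add_one ((x + (n + 1)) * (n + 1))
  rw [gridIndex, min_eq_left hle, gridPoint]
  constructor
  · rw [le_sub_iff_add_le, le_div_iff₀ hn]
    exact h4.le
  · rw [add_div, sub_le_iff_le_add, add_right_comm]
    gcongr
    rw [div_le_iff₀ hn]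
    exact h3

theorem tendsto_grid (φ : (Fin d → ℝ) → ℝ) (hφ : RightContinuous φ) (x : Fin d → ℝ) :
    Tendsto (fun n : ℕ => φ fun i => gridPoint n (gridIndex n (x i))) atTop (𝓝 (φ x)) := by
  have hev : ∀ᶠ n : ℕ in atTop, ∀ i, |x i| ≤ n := eventually_all.2 fun i =>
    tendsto_natCast_atTop_atTop.eventually_ge_atTop _
  refine (hφ x).tendsto.comp (tendsto_nhdsWithin_iff.2 ⟨tendsto_pi_nhds.2 fun i => ?_, ?_⟩)
  · have h2 : Tendsto (fun n : ℕ => x i + 1 / ((n : ℝ) + 1)) atTop (𝓝 (x i)) := by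
      simpa using tendsto_one_div_add_atTop_nhds_zero_nat.const_add (x i)
    refine tendsto_of_tendsto_of_tendsto_of_le_of_le' tendsto_const_nhds h2 ?_ ?_
    · filter_upwards [hev] with n hn using (gridPoint_gridIndex_bounds (hn i)).1
    · filter_upwards [hev] with n hn using (gridPoint_gridIndex_bounds (hn i)).2
  · filter_upwards [hev] with n hn i using (gridPoint_gridIndex_bounds (hn i)).1

/-- Comonotonic versions are maximal in the diamond supermodular order. -/
theorem IsComonotonicVersion.leSMDiamond [IsProbabilityMeasure P] (hd : 0 < d)
    {X Y : Fin d → Ω → ℝ} (hX : ∀ i, Measurable (X i)) (hY : IsComonotonicVersion P X Y) :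
    LeSMDiamond P X Y := by
  rintro φ hφ ⟨C, hC⟩ hφr
  have hlim : ∀ V : Fin d → Ω → ℝ, (∀ i, Measurable (V i)) →
      Tendsto (fun n : ℕ => ∫ ω, φ (fun i => gridPoint n (gridIndex n (V i ω))) ∂P) atTop
        (𝓝 (∫ ω, φ (vec V ω) ∂P)) := by
    intro V hV
    refine tendsto_integral_of_dominated_convergence (fun _ => C) (fun n => ?_)
      (integrable_const C) (fun n => .of_forall fun ω => hC _)
      (.of_forall fun ω => tendsto_grid φ hφr (vec V ω))
    exact ((Measurable.of_discrete
      (f := fun c : Fin d → ℕ => φ fun i => gridPoint n (c i))).comp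
      (measurable_pi_lambda (fun ω i => gridIndex n (V i ω))
        fun i => (monotone_gridIndex n).measurable.comp (hV i))).aestronglyMeasurable
  refine le_of_tendsto_of_tendsto' (hlim X hX) (hlim Y hY.1) fun n => ?_
  refine integral_le_of_isComonotonicVersion_discrete hd hX hY (monotone_gridIndex n)
    (N := 2 * (n + 1) ^ 2) (fun x => min_le_right _ _)
    (ψ := fun c => φ fun i => gridPoint n (c i)) fun x y => ?_
  -- A coordinatewise monotone map commutes with minima and maxima.
  convert hφ (fun i => gridPoint n (x i)) (fun i => gridPoint n (y i)) using 3
  · funext i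
    exact (monotone_gridPoint n).map_min
  · funext i
    exact (monotone_gridPoint n).map_max

end Diamond

/-! ### Comparison of the orders. -/

section Expectation

variable {Ω : Type*} [MeasurableSpace Ω] {P : Measure Ω}

theorem lintegral_ofReal_lt_top {Y : Ω → ℝ} (hY : Integrable Y P) :
    ∫⁻ ω, ENNReal.ofReal (Y ω) ∂P < ⊤ :=
  lt_of_le_of_lt (lintegral_mono fun _ => Real.ofReal_le_enorm _) hY.2

theorem expectation_eq_integral {Y : Ω → ℝ} (hY : Integrable Y P) :
    expectation P Y = ((∫ ω, Y ω ∂P : ℝ) : EReal) := by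
  rw [integral_eq_lintegral_pos_part_sub_lintegral_neg_part hY, EReal.coe_sub, expectation,
    EReal.coe_ennreal_toReal (lintegral_ofReal_lt_top hY).ne,
    EReal.coe_ennreal_toReal (lintegral_ofReal_lt_top (Y := fun ω => -Y ω) hY.neg).ne]

/-- Used in contrapositive form: a failure with finite expectations refutes both orders. -/
theorem LeSM.leSMDagger {d : ℕ} {X Y : Fin d → Ω → ℝ} (h : LeSM P X Y) : LeSMDagger P X Y := by
  intro φ hφ hX hY
  have := h φ hφ ⟨hX.aemeasurable, Or.inl (lintegral_ofReal_lt_top hX)⟩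
    ⟨hY.aemeasurable, Or.inl (lintegral_ofReal_lt_top hY)⟩
  rw [expectation_eq_integral hX, expectation_eq_integral hY] at this
  exact_mod_cast this

end Expectation

/-! ### The function `phiEx` and the integral behind the example. -/

/-- In each coordinate minimum and maximum merely permute the two values, so equality holds. -/
theorem Separable.supermodular {d : ℕ} {φ : (Fin d → ℝ) → ℝ} (h : Separable φ) :
    Supermodular φ := by
  obtain ⟨g, hg⟩ := h
  intro x y
  simp only [hg, ← Finset.sum_add_distrib]
  refine (Finset.sum_congr rfl fun i _ => ?_).le
  rcases le_total (x i) (y i) with h | h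
  · simp [h]
  · simp [h, add_comm]

theorem separable_phiEx : Separable phiEx :=
  ⟨![(Set.Ioo (0 : ℝ) 1).indicator fun t => 1 / t, (Set.Ioo (0 : ℝ) 1).indicator fun t => 1 / t,
    fun s => -(Set.Ioo (0 : ℝ) 1).indicator (fun t => 2 / t) s], fun x => by
    simp [Fin.sum_univ_three, phiEx, sub_eq_add_neg]⟩

theorem not_boundedFun_phiEx : ¬ BoundedFun phiEx := by
  rintro ⟨C, hC⟩
  have hC0 : 0 ≤ C := (abs_nonneg _).trans (hC 0)
  have hpos : 0 < C + 2 := by linarith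
  have hmem : (C + 2)⁻¹ ∈ Set.Ioo (0 : ℝ) 1 := ⟨inv_pos.2 hpos, inv_lt_one_of_one_lt₀ (by linarith)⟩
  have h := hC ![(C + 2)⁻¹, 0, 0]
  have hval : phiEx ![(C + 2)⁻¹, 0, 0] = C + 2 := by
    simp [phiEx, Set.indicator_of_mem hmem]
  rw [hval, abs_of_pos hpos] at h
  linarith

theorem phiEx_eq_zero {x : Fin 3 → ℝ} (h1 : x 1 = x 0) (h2 : x 2 = x 0) : phiEx x = 0 := by
  unfold phiEx
  rw [h1, h2]
  by_cases h : x 0 ∈ Set.Ioo (0 : ℝ) 1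
  · simp only [Set.indicator_of_mem h]
    ring
  · simp only [Set.indicator_of_notMem h]
    ring

/-- The term `2 / (2 min)` cancels the larger of the two reciprocals. At `u = 1 / 2` the third
coordinate is `1`, where its indicator vanishes, and the identity fails. -/
theorem phiEx_reflection {u : ℝ} (hu : u ∈ Set.Ioo (0 : ℝ) 1) (hu' : u ≠ 1 / 2) :
    phiEx ![u, 1 - u, 2 * min u (1 - u)] = 1 / max u (1 - u) := by
  obtain ⟨h0, h1⟩ := hu
  have h1' : 0 < 1 - u := by linarith
  have hu1 : u ∈ Set.Ioo (0 : ℝ) 1 := ⟨h0, h1⟩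
  have hu2 : 1 - u ∈ Set.Ioo (0 : ℝ) 1 := ⟨h1', by linarith⟩
  rcases lt_or_gt_of_ne hu' with h | h
  · have hle : u ≤ 1 - u := by linarith
    have hu3 : 2 * u ∈ Set.Ioo (0 : ℝ) 1 := ⟨by linarith, by linarith⟩
    simp only [phiEx, Matrix.cons_val, min_eq_left hle, max_eq_right hle,
      Set.indicator_of_mem hu1, Set.indicator_of_mem hu2, Set.indicator_of_mem hu3]
    field_simp
    ring
  · have hle : 1 - u ≤ u := by linarith
    have hu3 : 2 * (1 - u) ∈ Set.Ioo (0 : ℝ) 1 := ⟨by linarith, by linarith⟩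
    simp only [phiEx, Matrix.cons_val, min_eq_right hle, max_eq_left hle,
      Set.indicator_of_mem hu1, Set.indicator_of_mem hu2, Set.indicator_of_mem hu3]
    field_simp
    ring

theorem half_le_max_reflection (u : ℝ) : 1 / 2 ≤ max u (1 - u) := by
  rcases le_total u (1 / 2) with h | h
  · exact le_max_of_le_right (by linarith)
  · exact le_max_of_le_left h

theorem continuous_one_div_max_reflection : Continuous fun u : ℝ => 1 / max u (1 - u) :=
  continuous_const.div (by fun_prop) fun u => by
    have := half_le_max_reflection u
    positivity

theorem integral_one_div_max_reflection :
    ∫ u in (0 : ℝ)..1, 1 / max u (1 - u) = 2 * Real.log 2 := by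
  have hint := fun a b : ℝ => continuous_one_div_max_reflection.intervalIntegrable (μ := volume) a b
  have h0 : ∫ u in (1 / 2 : ℝ)..1, 1 / u = Real.log 2 := by
    rw [integral_one_div_of_pos (by norm_num) (by norm_num)]
    norm_num
  have h1 : ∫ u in (1 / 2 : ℝ)..1, 1 / max u (1 - u) = Real.log 2 := by
    rw [← h0]
    refine intervalIntegral.integral_congr fun u hu => ?_
    rw [Set.uIcc_of_le (by norm_num)] at hu
    rw [max_eq_left (by linarith [hu.1])]
  have h2 : ∫ u in (0 : ℝ)..1 / 2, 1 / max u (1 - u) = Real.log 2 := by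
    calc ∫ u in (0 : ℝ)..1 / 2, 1 / max u (1 - u) = ∫ u in (0 : ℝ)..1 / 2, 1 / (1 - u) := by
          refine intervalIntegral.integral_congr fun u hu => ?_
          rw [Set.uIcc_of_le (by norm_num)] at hu
          rw [max_eq_right (by linarith [hu.2])]
      _ = ∫ u in (1 - 1 / 2 : ℝ)..1 - 0, 1 / u :=
          intervalIntegral.integral_comp_sub_left (fun u : ℝ => 1 / u) 1
      _ = Real.log 2 := by rw [← h0]; norm_num
  rw [← intervalIntegral.integral_add_adjacent_intervals (hint 0 (1 / 2)) (hint (1 / 2) 1), h1, h2]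
  ring

/-! ### The reflection triple as counterexample. -/

section Example

variable {Ω : Type*}

/-- A uniform variable, its reflection, and twice the smaller one of the two. -/
def reflectionTriple (U : Ω → ℝ) : Fin 3 → Ω → ℝ :=
  ![U, fun ω => 1 - U ω, fun ω => 2 * min (U ω) (1 - U ω)]

theorem vec_reflectionTriple (U : Ω → ℝ) (ω : Ω) :
    vec (reflectionTriple U) ω = ![U ω, 1 - U ω, 2 * min (U ω) (1 - U ω)] := by
  funext i
  fin_cases i <;> rfl

/-- The reflection triple, extended by zeros to a vector of length `d`. -/
def extendedTriple (d : ℕ) (U : Ω → ℝ) (i : Fin d) : Ω → ℝ :=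
  if h : (i : ℕ) < 3 then reflectionTriple U ⟨i, h⟩ else 0

theorem extendedTriple_castLE {d : ℕ} (hd : 3 ≤ d) (U : Ω → ℝ) (i : Fin 3) :
    extendedTriple d U (i.castLE hd) = reflectionTriple U i := by
  simp [extendedTriple]

variable [MeasurableSpace Ω] {P : Measure Ω} {U : Ω → ℝ}

theorem measurable_reflectionTriple (hU : Measurable U) (i : Fin 3) :
    Measurable (reflectionTriple U i) := by
  fin_cases i
  · exact hU
  · exact hU.const_sub 1
  · exact (hU.min (hU.const_sub 1)).const_mul 2

theorem isUniform_reflectionTriple [IsProbabilityMeasure P] (hU : Measurable U)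
    (hu : pdf.IsUniform U (Set.Icc (0 : ℝ) 1) P volume) (i : Fin 3) :
    pdf.IsUniform (reflectionTriple U i) (Set.Icc (0 : ℝ) 1) P volume := by
  have hm := measurable_reflectionTriple hU i
  fin_cases i
  · exact hu
  · refine isUniform_Icc_of_measureReal_le hm fun t ht => ?_
    have e : {ω | 1 - U ω ≤ t} = U ⁻¹' Set.Ici (1 - t) := by
      ext ω
      simp only [Set.mem_ofPred_eq, Set.mem_preimage, Set.mem_Ici]
      constructor <;> intro <;> linarith
    have e' : Set.Icc (0 : ℝ) 1 ∩ Set.Ici (1 - t) = Set.Icc (1 - t) 1 := by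
      ext x
      simp only [Set.mem_inter_iff, Set.mem_Icc, Set.mem_Ici]
      exact ⟨fun h => ⟨h.2, h.1.2⟩, fun h => ⟨⟨by linarith [ht.2], h.2⟩, h.1⟩⟩
    change P.real {ω | 1 - U ω ≤ t} = t
    rw [e, measureReal_def, measure_preimage_of_isUniform_Icc hu measurableSet_Ici, e',
      Real.volume_Icc, ENNReal.toReal_ofReal (by linarith [ht.1])]
    ring
  · refine isUniform_Icc_of_measureReal_le hm fun t ht => ?_
    have e : {ω | 2 * min (U ω) (1 - U ω) ≤ t} = (U ⁻¹' Set.Ioo (t / 2) (1 - t / 2))ᶜ := by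
      ext ω
      simp only [Set.mem_ofPred_eq, Set.mem_compl_iff, Set.mem_preimage, Set.mem_Ioo]
      rw [← not_lt, not_iff_not, ← div_lt_iff₀' two_pos, lt_min_iff]
      constructor <;> rintro ⟨h1, h2⟩ <;> constructor <;> linarith
    have e' : Set.Icc (0 : ℝ) 1 ∩ Set.Ioo (t / 2) (1 - t / 2) = Set.Ioo (t / 2) (1 - t / 2) := by
      refine Set.inter_eq_right.2 fun x hx => ⟨?_, ?_⟩
      · linarith [hx.1, ht.1]
      · linarith [hx.2, ht.1]
    change P.real {ω | 2 * min (U ω) (1 - U ω) ≤ t} = t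
    rw [e, probReal_compl_eq_one_sub (hU measurableSet_Ioo), measureReal_def,
      measure_preimage_of_isUniform_Icc hu measurableSet_Ioo, e', Real.volume_Ioo,
      ENNReal.toReal_ofReal (by linarith [ht.2])]
    ring

theorem counterMonotonicPair_reflection (hU : Measurable U) :
    CounterMonotonicPair P (reflectionTriple U 0) (reflectionTriple U 1) :=
  ⟨U, id, fun z => -(1 - z), hU, monotone_id, fun a b h => by simpa using h,
    .of_forall fun _ => rfl, .of_forall fun _ => rfl⟩

/-- If `w = 1/u + 1/(1 - u) = 1/(u(1 - u))`, then `√(1 - 4/w) = |1 - 2u|`, so this function of `w`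
is `-2 min(u, 1 - u)`. Such `w` is at least `4`; the truncation only secures monotonicity on the
whole line. -/
theorem monotone_sqrt_one_sub_div :
    Monotone fun w : ℝ => Real.sqrt (1 - 4 / max w 4) - 1 := fun a b h => by
  have : (0 : ℝ) < max a 4 := lt_max_of_lt_right (by norm_num)
  simp only
  gcongr

theorem counterMonotonicPair_sum_inv (hU : Measurable U)
    (hu : pdf.IsUniform U (Set.Icc (0 : ℝ) 1) P volume) :
    CounterMonotonicPair P (fun ω => 1 / reflectionTriple U 0 ω + 1 / reflectionTriple U 1 ω)
      (reflectionTriple U 2) := by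
  refine ⟨fun ω => 1 / U ω + 1 / (1 - U ω), id, _, by fun_prop, monotone_id,
    monotone_sqrt_one_sub_div, .of_forall fun _ => rfl, ?_⟩
  filter_upwards [ae_mem_Ioo_of_isUniform_Icc hu] with ω hω
  change -(2 * min (U ω) (1 - U ω)) = _
  generalize U ω = u at hω
  obtain ⟨h0, h1⟩ := hω
  have h1' : 0 < 1 - u := by linarith
  have hw : 1 / u + 1 / (1 - u) = 1 / (u * (1 - u)) := by
    field_simp
    ring
  have h4 : 4 ≤ 1 / (u * (1 - u)) := by
    rw [le_div_iff₀ (by positivity)]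
    nlinarith [sq_nonneg (1 - 2 * u)]
  have hsq : 1 - 4 / (1 / (u * (1 - u))) = (1 - 2 * u) ^ 2 := by
    rw [div_div_eq_mul_div]
    ring
  rw [hw, max_eq_left h4, hsq, Real.sqrt_sq_eq_abs]
  rcases le_total u (1 / 2) with h | h
  · rw [min_eq_left (by linarith), abs_of_nonneg (by linarith)]
    ring
  · rw [min_eq_right (by linarith), abs_of_nonpos (by linarith)]
    ring

theorem phiEx_reflectionTriple_ae_eq (hu : pdf.IsUniform U (Set.Icc (0 : ℝ) 1) P volume) :
    (fun ω => phiEx (vec (reflectionTriple U) ω)) =ᵐ[P]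
      fun ω => 1 / max (U ω) (1 - U ω) := by
  have hne : ∀ᵐ ω ∂P, U ω ≠ 1 / 2 := by
    rw [ae_iff]
    have e : {ω | ¬ U ω ≠ 1 / 2} = U ⁻¹' {1 / 2} := by ext; simp
    rw [e, measure_preimage_of_isUniform_Icc hu (measurableSet_singleton _)]
    exact measure_mono_null Set.inter_subset_right Real.volume_singleton
  filter_upwards [ae_mem_Ioo_of_isUniform_Icc hu, hne] with ω h1 h2
  rw [vec_reflectionTriple]
  exact phiEx_reflection h1 h2

theorem integrable_phiEx_reflectionTriple [IsFiniteMeasure P] (hU : Measurable U)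
    (hu : pdf.IsUniform U (Set.Icc (0 : ℝ) 1) P volume) :
    Integrable (fun ω => phiEx (vec (reflectionTriple U) ω)) P := by
  refine Integrable.congr ?_ (phiEx_reflectionTriple_ae_eq hu).symm
  refine Integrable.of_bound
    (continuous_one_div_max_reflection.measurable.comp hU).aestronglyMeasurable 2
    (.of_forall fun ω => ?_)
  have h := half_le_max_reflection (U ω)
  have hpos : 0 < max (U ω) (1 - U ω) := by linarith
  rw [Real.norm_of_nonneg (by positivity), div_le_iff₀ hpos]
  linarith

theorem integral_phiEx_reflectionTriple (hU : Measurable U)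
    (hu : pdf.IsUniform U (Set.Icc (0 : ℝ) 1) P volume) :
    ∫ ω, phiEx (vec (reflectionTriple U) ω) ∂P = 2 * Real.log 2 := by
  rw [integral_congr_ae (phiEx_reflectionTriple_ae_eq hu),
    ← integral_map (f := fun u => 1 / max u (1 - u)) hU.aemeasurable
      continuous_one_div_max_reflection.aestronglyMeasurable, hu, ProbabilityTheory.cond,
    volume_Icc_zero_one, inv_one, one_smul, integral_Icc_eq_integral_Ioc,
    ← intervalIntegral.integral_of_le zero_le_one, integral_one_div_max_reflection]

theorem IsComonotonicVersion.comp {d k : ℕ} {X Y : Fin d → Ω → ℝ} (h : IsComonotonicVersion P X Y)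
    {e : Fin k → Fin d} (he : Function.Injective e) :
    IsComonotonicVersion P (fun i => X (e i)) (fun i => Y (e i)) :=
  ⟨fun i => h.1 (e i), fun _ _ hij => h.2.1 _ _ (he.ne hij), fun i => h.2.2 (e i)⟩

theorem IsComonotonicVersion.phiEx_ae_eq_zero [IsFiniteMeasure P] {X Y : Fin 3 → Ω → ℝ}
    (hX : ∀ i, IdentDistrib (X i) (X 0) P P) (hY : IsComonotonicVersion P X Y) :
    ∀ᵐ ω ∂P, phiEx (vec Y ω) = 0 := by
  have h : ∀ i, i ≠ 0 → Y i =ᵐ[P] Y 0 := fun i hi =>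
    (hY.2.1 i 0 hi).ae_eq_of_identDistrib (hY.1 i) (hY.1 0)
      (((hY.2.2 i).trans (hX i)).trans (hY.2.2 0).symm)
  filter_upwards [h 1 (by decide), h 2 (by decide)] with ω h1 h2
  exact phiEx_eq_zero h1 h2

theorem identDistrib_reflectionTriple [IsProbabilityMeasure P] (hU : Measurable U)
    (hu : pdf.IsUniform U (Set.Icc (0 : ℝ) 1) P volume) (i : Fin 3) :
    IdentDistrib (reflectionTriple U i) (reflectionTriple U 0) P P :=
  ⟨(measurable_reflectionTriple hU i).aemeasurable, (measurable_reflectionTriple hU 0).aemeasurable,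
    (isUniform_reflectionTriple hU hu i).trans (isUniform_reflectionTriple hU hu 0).symm⟩

theorem measurable_extendedTriple {d : ℕ} (hU : Measurable U) (i : Fin d) :
    Measurable (extendedTriple d U i) := by
  unfold extendedTriple
  split_ifs
  · exact measurable_reflectionTriple hU _
  · exact measurable_const

theorem memLp_top_extendedTriple [IsProbabilityMeasure P] {d : ℕ} (hU : Measurable U)
    (hu : pdf.IsUniform U (Set.Icc (0 : ℝ) 1) P volume) (i : Fin d) :
    MemLp (extendedTriple d U i) ⊤ P := by
  unfold extendedTriple
  split_ifs with h
  · refine memLp_top_of_bound (measurable_reflectionTriple hU _).aestronglyMeasurable 1 ?_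
    filter_upwards [ae_mem_Ioo_of_isUniform_Icc (isUniform_reflectionTriple hU hu ⟨i, h⟩)]
      with ω hω
    rw [Real.norm_of_nonneg hω.1.le]
    exact hω.2.le
  · exact MemLp.zero

/-- The test function is `phiEx` of the first three coordinates, supermodular because projections
preserve minima and maxima. Domination would give `2 log 2 ≤ 0`. -/
theorem not_leSMDagger_extendedTriple [IsProbabilityMeasure P] {d : ℕ} (hd : 3 ≤ d)
    (hU : Measurable U) (hu : pdf.IsUniform U (Set.Icc (0 : ℝ) 1) P volume) {Y : Fin d → Ω → ℝ}
    (hY : IsComonotonicVersion P (extendedTriple d U) Y) :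
    ¬ LeSMDagger P (extendedTriple d U) Y := by
  intro h
  have hX : ∀ ω, (fun i : Fin 3 => vec (extendedTriple d U) ω (i.castLE hd)) =
      vec (reflectionTriple U) ω := fun ω => by
    funext i
    simp only [vec, extendedTriple_castLE]
  have hY' := hY.comp (Fin.castLE_injective hd)
  simp only [extendedTriple_castLE] at hY'
  have h0 : (fun ω => phiEx fun i : Fin 3 => vec Y ω (i.castLE hd)) =ᵐ[P] 0 :=
    hY'.phiEx_ae_eq_zero (identDistrib_reflectionTriple hU hu)
  have hle := h (fun x => phiEx fun i => x (i.castLE hd))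
    (fun x y => separable_phiEx.supermodular (fun i => x (i.castLE hd)) fun i => y (i.castLE hd))
    (by simpa only [hX] using integrable_phiEx_reflectionTriple hU hu)
    ((integrable_zero Ω ℝ P).congr h0.symm)
  simp only [hX] at hle
  rw [integral_phiEx_reflectionTriple hU hu, integral_congr_ae h0] at hle
  have := Real.log_pos one_lt_two
  simp at hle
  linarith

end Example

end SMOrder

end

/-! ### Assembly of the three claims. -/

theorem proposition7 {Ω : Type*} [MeasurableSpace Ω] (P : Measure Ω) [IsProbabilityMeasure P]
    (hP : SMOrder.Atomless P) :
    -- for `d ≥ 2`, every random vector has comonotonic versions, and they dominate it in the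
    -- diamond supermodular order
    (∀ d : ℕ, 2 ≤ d → ∀ X : Fin d → Ω → ℝ, (∀ i, Measurable (X i)) →
      (∃ Xco, SMOrder.IsComonotonicVersion P X Xco) ∧
      ∀ Xco, SMOrder.IsComonotonicVersion P X Xco → SMOrder.LeSMDiamond P X Xco) ∧
    -- for `d ≥ 3`, domination fails in the two other orders for some essentially bounded vector
    (∀ d : ℕ, 3 ≤ d → ∃ X : Fin d → Ω → ℝ,
      (∀ i, Measurable (X i)) ∧ (∀ i, MemLp (X i) ⊤ P) ∧
      (∃ Xco, SMOrder.IsComonotonicVersion P X Xco) ∧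
      ∀ Xco, SMOrder.IsComonotonicVersion P X Xco →
        ¬ SMOrder.LeSMDagger P X Xco ∧ ¬ SMOrder.LeSM P X Xco) ∧
    -- the explicit example with three standard uniform random variables
    (SMOrder.Supermodular SMOrder.phiEx ∧ SMOrder.Separable SMOrder.phiEx ∧
      ¬ SMOrder.BoundedFun SMOrder.phiEx ∧
      ∃ X : Fin 3 → Ω → ℝ,
        (∀ i, Measurable (X i)) ∧
        (∀ i, pdf.IsUniform (X i) (Set.Icc (0 : ℝ) 1) P volume) ∧
        SMOrder.CounterMonotonicPair P (X 0) (X 1) ∧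
        SMOrder.CounterMonotonicPair P (fun ω => 1 / X 0 ω + 1 / X 1 ω) (X 2) ∧
        Integrable (fun ω => SMOrder.phiEx (SMOrder.vec X ω)) P ∧
        ∫ ω, SMOrder.phiEx (SMOrder.vec X ω) ∂P = 2 * Real.log 2 ∧ 0 < 2 * Real.log 2 ∧
        ∀ Xco, SMOrder.IsComonotonicVersion P X Xco →
          ∀ᵐ ω ∂P, SMOrder.phiEx (SMOrder.vec Xco ω) = 0) := by
  obtain ⟨U, hU, hu⟩ := hP.exists_isUniform
  refine ⟨fun d hd X hX => ⟨hP.exists_isComonotonicVersion hX, fun Xco hco =>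
    hco.leSMDiamond (by omega) hX⟩, fun d hd => ?_, ?_⟩
  · refine ⟨SMOrder.extendedTriple d U, SMOrder.measurable_extendedTriple hU,
      SMOrder.memLp_top_extendedTriple hU hu,
      hP.exists_isComonotonicVersion (SMOrder.measurable_extendedTriple hU), fun Xco hco => ?_⟩
    have h := SMOrder.not_leSMDagger_extendedTriple hd hU hu hco
    exact ⟨h, fun h' => h h'.leSMDagger⟩
  · exact ⟨SMOrder.separable_phiEx.supermodular, SMOrder.separable_phiEx,
      SMOrder.not_boundedFun_phiEx, SMOrder.reflectionTriple U,
      SMOrder.measurable_reflectionTriple hU, SMOrder.isUniform_reflectionTriple hU hu,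
      SMOrder.counterMonotonicPair_reflection hU, SMOrder.counterMonotonicPair_sum_inv hU hu,
      SMOrder.integrable_phiEx_reflectionTriple hU hu,
      SMOrder.integral_phiEx_reflectionTriple hU hu,
      mul_pos two_pos (Real.log_pos one_lt_two), fun Xco hco =>
      hco.phiEx_ae_eq_zero (SMOrder.identDistrib_reflectionTriple hU hu)⟩
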